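/- Let $1<p\le 2\le q<\infty$. There is a constant $C<\infty$, depending only on $p$ and $q$, with the following property. Let $n,k,l\ge 1$ be integers and let $A_{k,l}=(-\Delta)^l+|x|^{2k}+1$ on $\mathbb R^n$. Let $(u_j)_{j\in\mathbb N}$ be an orthonormal basis of $L^2(\mathbb R^n)$ (complex-valued functions) consisting of eigenfunctions of $A_{k,l}$, with corresponding real eigenvalues $(\lambda_j)_{j\in\mathbb N}$, that is, $A_{k,l}u_j=\lambda_j u_j$ in the sense of tempered distributions. For $f\in L^2(\mathbb R^n)$ put $$\mathcal F_{A_{k,l}}f(j)=\int_{\mathbb R^n} f(x)\overline{u_j(x)}\,dx,\qquad j\in\mathbb N,$$ and let $C^\infty_{A_{k,l}}(\mathbb R^n)=\bigcap_{m\ge1}\{f\in L^2(\mathbb R^n):\sum_j\lambda_j^{2m}|\langle u_j,f\rangle_{L^2}|^2<\infty\}$. Let $\sigma_A:\mathbb N\to\mathbb C$ be a function and let $A$ be an $A_{k,l}$-Fourier multiplier with symbol $\sigma_A$, i.e. a linear operator $A:\mathrm{Dom}(A)\to L^2(\mathbb R^n)$ on a linear subspace $\mathrm{Dom}(A)\subseteq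 L^2(\mathbb R^n)$ with $C^\infty_{A_{k,l}}(\mathbb R^n)\subseteq\mathrm{Dom}(A)$ such that $$\mathcal F_{A_{k,l}}(Af)(j)=\sigma_A(j)\,\mathcal F_{A_{k,l}}f(j),\qquad f\in\mathrm{Dom}(A),\ j\in\mathbb N.$$ Let $\|A\|_{L^p(\mathbb R^n)\to L^q(\mathbb R^n)}\in[0,\infty]$ be the least $M$ with $\|Af\|_{L^q}\le M\|f\|_{L^p}$ for all $f\in \mathrm{Dom}(A)\cap L^p(\mathbb R^n)$, and let $$B=\sup_{s>0}\ s\Bigl(\sum_{j\in\mathbb N,\ |\sigma_A(j)|\ge s}\|u_j\|_{L^\infty(\mathbb R^n)}^2\Bigr)^{\frac1p-\frac1q}\in[0,\infty],$$ where those $s$ for which no $j$ satisfies $|\sigma_A(j)|\ge s$ contribute $0$ (this matters only when $p=q=2$; then $B=\sup_j|\sigma_A(j)|$). Then $$\|A\|_{L^p(\mathbb R^n)\to L^q(\mathbb R^n)}\le C\,B.$$ Moreover, if $B<\infty$, then there is exactly one bounded linear operator $T:L^p(\mathbb R^n)\to L^q(\mathbb R^n)$ with $Tf=Af$ for all $f\in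 \mathrm{Dom}(A)\cap L^p(\mathbb R^n)$, and $\|T\|\le C\,B$. -/

import Mathlib

open MeasureTheory
open scoped ENNReal NNReal SchwartzMap Laplacian ComplexConjugate

namespace Anharmonic

/-- The complex Hilbert space `L²(ℝⁿ)` with respect to Lebesgue measure. -/
abbrev L2 (n : ℕ) : Type :=
  Lp ℂ 2 (volume : Measure (EuclideanSpace ℝ (Fin n)))

/-- The operator `T ↦ -ΔT` on tempered distributions. -/
noncomputable def negLaplacian (n : ℕ) (T : 𝓢'(EuclideanSpace ℝ (Fin n), ℂ)) :
    𝓢'(EuclideanSpace ℝ (Fin n), ℂ) :=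
  -(Δ T)

/-- The anharmonic oscillator `A_{k,l} = (-Δ)^l + |x|^{2k} + 1`, acting on tempered distributions
on `ℝⁿ`. -/
noncomputable def oscillator (n k l : ℕ) (T : 𝓢'(EuclideanSpace ℝ (Fin n), ℂ)) :
    𝓢'(EuclideanSpace ℝ (Fin n), ℂ) :=
  (negLaplacian n)^[l] T +
    TemperedDistribution.smulLeftCLM ℂ
      (fun x : EuclideanSpace ℝ (Fin n) => ((‖x‖ ^ (2 * k) : ℝ) : ℂ)) T + T

/-- The weight `|x|^{2k}` has temperate growth, so that multiplication by it in `oscillator` is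
the genuine multiplication of a tempered distribution by a function. -/
theorem hasTemperateGrowth_weight (n k : ℕ) :
    (fun x : EuclideanSpace ℝ (Fin n) => ((‖x‖ ^ (2 * k) : ℝ) : ℂ)).HasTemperateGrowth := by
  have h : (fun x : EuclideanSpace ℝ (Fin n) => ‖x‖ ^ (2 * k)).HasTemperateGrowth := by
    simp_rw [pow_mul]
    exact (Function.hasTemperateGrowth_norm_sq (EuclideanSpace ℝ (Fin n))).pow k
  fun_prop

/-- `(u_j)` is an orthonormal (Hilbert) basis of `L²(ℝⁿ)` consisting of eigenfunctions of
`A_{k,l}`, with corresponding (real) eigenvalues `lam j`: each `u_j ∈ L²(ℝⁿ)` satisfies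
`A_{k,l} u_j = lam_j u_j` in the sense of tempered distributions. -/
def IsEigenbasis (n k l : ℕ) (u : HilbertBasis ℕ ℂ (L2 n)) (lam : ℕ → ℝ) : Prop :=
  ∀ j, oscillator n k l (Lp.toTemperedDistribution (u j)) =
    (lam j : ℂ) • Lp.toTemperedDistribution (u j)

/-- The `A_{k,l}`-Fourier transform `(F f)(j) = ∫ f(x) conj(u_j(x)) dx`. -/
noncomputable def oscFourier {n : ℕ} (u : HilbertBasis ℕ ℂ (L2 n))
    (f : EuclideanSpace ℝ (Fin n) → ℂ) (j : ℕ) : ℂ :=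
  ∫ x, f x * conj (u j x)

/-- `Dom(A_{k,l}^m) = {f ∈ L² : ∑_j lam_j^{2m} |⟨u_j, f⟩|² < ∞}`. -/
def domPow {n : ℕ} (u : HilbertBasis ℕ ℂ (L2 n)) (lam : ℕ → ℝ) (m : ℕ) : Set (L2 n) :=
  {f | Summable fun j => lam j ^ (2 * m) * ‖inner ℂ (u j) f‖ ^ 2}

/-- The space `C^∞_{A_{k,l}}(ℝⁿ) = ⋂_{m ≥ 1} Dom(A_{k,l}^m)` of smooth vectors. -/
def smoothVectors {n : ℕ} (u : HilbertBasis ℕ ℂ (L2 n)) (lam : ℕ → ℝ) : Set (L2 n) :=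
  ⋂ (m : ℕ) (_ : 1 ≤ m), domPow u lam m

/-- `A` is an `A_{k,l}`-Fourier multiplier with symbol `σ`: it is a linear operator in `L²(ℝⁿ)`,
defined at least on the smooth vectors, with `F(A f)(j) = σ(j) F f(j)` on its domain. -/
structure IsFourierMultiplier {n : ℕ} (u : HilbertBasis ℕ ℂ (L2 n)) (lam : ℕ → ℝ)
    (σ : ℕ → ℂ) (A : L2 n →ₗ.[ℂ] L2 n) : Prop where
  smooth_subset_domain : smoothVectors u lam ⊆ A.domain
  fourier_apply : ∀ (f : A.domain) (j : ℕ), oscFourier u (A f) j = σ j * oscFourier u (f : L2 n) j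

/-- The norm `‖A‖_{L^p → L^q} ∈ [0,∞]`: the least `M` such that `‖A f‖_q ≤ M ‖f‖_p` for all
`f ∈ L^p` in the domain of `A`. It is `∞` when there is no finite such `M`. -/
noncomputable def opNorm {n : ℕ} (A : L2 n →ₗ.[ℂ] L2 n) (p q : ℝ≥0∞) : ℝ≥0∞ :=
  sInf {M : ℝ≥0∞ | ∀ f : A.domain, MemLp (f : L2 n) p volume →
    eLpNorm (A f) q volume ≤ M * eLpNorm (f : L2 n) p volume}

/-- The quantity `sup_{s>0} s (∑_{j : |σ(j)| ≥ s} ‖u_j‖_∞²)^a ∈ [0,∞]`. The supremum is over those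
`s > 0` for which the index set is not empty, that is, an empty sum contributes `0`, also when
`a = 0`. For `a = 0` this makes the quantity equal to `sup_j |σ(j)|`. -/
noncomputable def symbolBound {n : ℕ} (u : HilbertBasis ℕ ℂ (L2 n)) (σ : ℕ → ℂ) (a : ℝ) : ℝ≥0∞ :=
  ⨆ (s : ℝ) (_ : 0 < s) (_ : ∃ j, s ≤ ‖σ j‖),
    ENNReal.ofReal s * (∑' j : {j : ℕ // s ≤ ‖σ j‖}, eLpNorm (u j) ∞ volume ^ 2) ^ a

/-- `T` extends `A`: it agrees with `A` on all elements of the domain of `A` that lie in `L^p`. -/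
def Extends {n : ℕ} {p q : ℝ≥0∞} [Fact (1 ≤ p)] [Fact (1 ≤ q)] (A : L2 n →ₗ.[ℂ] L2 n)
    (T : Lp ℂ p (volume : Measure (EuclideanSpace ℝ (Fin n))) →L[ℂ]
      Lp ℂ q (volume : Measure (EuclideanSpace ℝ (Fin n)))) : Prop :=
  ∀ (f : A.domain) (hf : MemLp (f : L2 n) p volume), T (hf.toLp _) =ᵐ[volume] A f

end Anharmonic

namespace Anharmonic

/-! By duality, the `L^q` bound for `A f` follows from bounds on `⟨g, A f⟩` for `g ∈ L²`, measured
in `L^{q'}` with `q'` conjugate to `q` (`eLpNorm_le_of_enorm_inner_le`). Parseval turns this pairing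
into a sum over `j` of `σ j` times the coefficients of `f` and `g`. Write `|σ| = |σ|^s |σ|^t` with
`s + t = 1`, where `s` and `t` are proportional to `1/p - 1/2` and `1/q' - 1/2`. Cauchy–Schwarz
leaves two weighted `ℓ²` norms of coefficients, one of `f` and one of `g`, each controlled by the
Paley-type inequality `tsum_ofReal_sq_mul_enorm_inner_sq_le`.

The Paley inequality is proved by a real-interpolation argument with explicit constants. The weight
is written by layer cake as an integral over levels `s`. At each level, `f` is cut where `s
|f|^((2-p)/2) = 1`: the large part is estimated by sup norms of the basis functions, the small part
by Bessel. Tonelli then integrates in `s` pointwise in `x`, and both parts produce `|f|^p`. Only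
orthonormality is used, so the constant depends on `p` and `q` alone.

The eigenvalue equation matters only for the extension: it makes Schwartz functions smooth vectors,
so `Dom(A) ∩ L^p` is dense in `L^p`. -/

/-! ### Coefficient bounds: Bessel, Cauchy–Schwarz, and cutting along a set. -/

theorem tsum_enorm_inner_sq_le {E ι : Type*} [NormedAddCommGroup E] [InnerProductSpace ℂ E]
    {v : ι → E} (hv : Orthonormal ℂ v) (x : E) :
    ∑' i, ‖inner ℂ (v i) x‖ₑ ^ 2 ≤ ‖x‖ₑ ^ 2 := by
  rw [ENNReal.tsum_eq_iSup_sum]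
  refine iSup_le fun s => ?_
  have h := hv.sum_inner_products_le x (s := s)
  simp only [← ofReal_norm, ← ENNReal.ofReal_pow (norm_nonneg _)]
  rw [← ENNReal.ofReal_sum_of_nonneg fun i _ => by positivity]
  exact ENNReal.ofReal_le_ofReal h

theorem tsum_mul_le_sqrt_mul_sqrt {ι : Type*} [Countable ι] (f g : ι → ℝ≥0∞) :
    ∑' i, f i * g i ≤ (∑' i, f i ^ 2) ^ (1 / 2 : ℝ) * (∑' i, g i ^ 2) ^ (1 / 2 : ℝ) := by
  let _ : MeasurableSpace ι := ⊤
  have h := ENNReal.lintegral_mul_le_Lp_mul_Lq (Measure.count : Measure ι)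
    Real.HolderConjugate.two_two (f := f) (g := g) (measurable_from_top).aemeasurable
    (measurable_from_top).aemeasurable
  simpa [lintegral_count, Pi.mul_apply] using h

section

variable {α : Type*} [MeasurableSpace α] {μ : Measure α}

theorem enorm_inner_le_eLpNorm_top_mul (v g : Lp ℂ 2 μ) :
    ‖inner ℂ v g‖ₑ ≤ eLpNorm v ∞ μ * ∫⁻ x, ‖g x‖ₑ ∂μ := by
  rw [L2.inner_def, ← lintegral_const_mul'' _ (Lp.aestronglyMeasurable g).enorm]
  refine (enorm_integral_le_lintegral_enorm _).trans (lintegral_mono_ae ?_)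
  rw [eLpNorm_exponent_top]
  filter_upwards [ae_le_eLpNormEssSup (f := v) (μ := μ)] with x hx
  calc ‖inner ℂ (v x) (g x)‖ₑ ≤ ‖v x‖ₑ * ‖g x‖ₑ := by
        rw [RCLike.inner_apply, enorm_mul, mul_comm]; simp
    _ ≤ _ := by gcongr

theorem add_sq_le_two_mul (a b : ℝ≥0∞) : (a + b) ^ 2 ≤ 2 * a ^ 2 + 2 * b ^ 2 := by
  have h := ENNReal.rpow_add_le_mul_rpow_add_rpow a b (p := 2) (by norm_num)
  norm_num at h
  rwa [mul_add] at h

theorem enorm_sq_eq_lintegral (f : Lp ℂ 2 μ) : ‖f‖ₑ ^ 2 = ∫⁻ x, ‖f x‖ₑ ^ 2 ∂μ := by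
  rw [Lp.enorm_def, eLpNorm_eq_lintegral_rpow_enorm_toReal (by simp) (by simp), ← ENNReal.rpow_natCast,
    ← ENNReal.rpow_mul]
  simp

/-- Cut `f` into its restrictions to `S` and `Sᶜ`: the first has coefficients bounded by sup norm
times `L¹` norm, the second obeys Bessel. In the application `S` varies with the level of the
weight. -/
theorem tsum_enorm_inner_sq_le_of_measurableSet {ι : Type*} {v : ι → Lp ℂ 2 μ}
    (hv : Orthonormal ℂ v) (f : Lp ℂ 2 μ) {S : Set α} (hS : MeasurableSet S) :
    ∑' i, ‖inner ℂ (v i) f‖ₑ ^ 2 ≤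
      2 * ((∑' i, eLpNorm (v i) ∞ μ ^ 2) * (∫⁻ x in S, ‖f x‖ₑ ∂μ) ^ 2) +
        2 * ∫⁻ x in Sᶜ, ‖f x‖ₑ ^ 2 ∂μ := by
  have hg := (Lp.memLp f).indicator hS
  have hh := (Lp.memLp f).indicator hS.compl
  have hsum : f = hg.toLp _ + hh.toLp _ := by
    rw [← MemLp.toLp_add]
    apply Lp.ext
    filter_upwards [(hg.add hh).coeFn_toLp] with x hx
    rw [hx, Set.indicator_self_add_compl S f]
  have hg1 : ∫⁻ x, ‖hg.toLp _ x‖ₑ ∂μ = ∫⁻ x in S, ‖f x‖ₑ ∂μ := by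
    rw [← lintegral_indicator hS]
    refine lintegral_congr_ae ?_
    filter_upwards [hg.coeFn_toLp] with x hx
    rw [hx, enorm_indicator_eq_indicator_enorm]
  have hh2 : ∫⁻ x, ‖hh.toLp _ x‖ₑ ^ 2 ∂μ = ∫⁻ x in Sᶜ, ‖f x‖ₑ ^ 2 ∂μ := by
    rw [← lintegral_indicator hS.compl]
    refine lintegral_congr_ae ?_
    filter_upwards [hh.coeFn_toLp] with x hx
    rw [hx]
    by_cases hxS : x ∈ Sᶜ <;> simp [hxS]
  calc ∑' i, ‖inner ℂ (v i) f‖ₑ ^ 2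
      ≤ ∑' i, (2 * ‖inner ℂ (v i) (hg.toLp _)‖ₑ ^ 2 + 2 * ‖inner ℂ (v i) (hh.toLp _)‖ₑ ^ 2) := by
        refine ENNReal.tsum_le_tsum fun i => ?_
        nth_rewrite 1 [hsum]
        rw [inner_add_right]
        exact (pow_le_pow_left' (enorm_add_le _ _) 2).trans (add_sq_le_two_mul _ _)
    _ ≤ _ := by
        rw [ENNReal.tsum_add, ENNReal.tsum_mul_left, ENNReal.tsum_mul_left]
        gcongr
        · rw [← ENNReal.tsum_mul_right]
          refine ENNReal.tsum_le_tsum fun i => ?_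
          rw [← mul_pow, ← hg1]
          gcongr
          exact enorm_inner_le_eLpNorm_top_mul _ _
        · rw [← hh2, ← enorm_sq_eq_lintegral]
          exact tsum_enorm_inner_sq_le hv _

/-! ### Level integrals for the Paley inequality. -/

theorem setLIntegral_Ioc_two_mul {t : ℝ} (ht : 0 ≤ t) :
    ∫⁻ s in Set.Ioc 0 t, ENNReal.ofReal (2 * s) = ENNReal.ofReal t ^ 2 := by
  rw [← ENNReal.ofReal_pow ht, ← ofReal_integral_eq_lintegral_ofReal]
  · rw [← intervalIntegral.integral_of_le ht]
    rw [intervalIntegral.integral_const_mul, integral_id]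
    congr 1
    ring
  · exact (Continuous.integrableOn_Ioc (by fun_prop))
  · filter_upwards [ae_restrict_mem measurableSet_Ioc] with s hs
    exact mul_nonneg zero_le_two hs.1.le

theorem setLIntegral_Ioi_rpow {t b : ℝ} (ht : 0 < t) (hb : 0 < b) :
    ∫⁻ s in Set.Ioi t, ENNReal.ofReal (s ^ (-1 - b)) = ENNReal.ofReal (t ^ (-b) / b) := by
  rw [← ofReal_integral_eq_lintegral_ofReal]
  · rw [integral_Ioi_rpow_of_lt (by linarith) ht]
    congr 1
    rw [show -1 - b + 1 = -b by ring]
    field_simp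
  · exact integrableOn_Ioi_rpow_of_lt (by linarith) ht
  · filter_upwards [ae_restrict_mem measurableSet_Ioi] with s hs
    exact Real.rpow_nonneg (ht.trans hs).le _

/-- Layer-cake representation of a weighted sum of squares. -/
theorem tsum_ofReal_sq_mul_eq_lintegral {ι : Type*} [Countable ι] {φ : ι → ℝ} (hφ : ∀ i, 0 ≤ φ i)
    (c : ι → ℝ≥0∞) :
    ∑' i, ENNReal.ofReal (φ i) ^ 2 * c i =
      ∫⁻ s in Set.Ioi 0, ENNReal.ofReal (2 * s) * ∑' i : {i // s ≤ φ i}, c i := by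
  have key : ∀ s : ℝ, ENNReal.ofReal (2 * s) * ∑' i : {i // s ≤ φ i}, c i =
      ∑' i, (Set.Iic (φ i)).indicator (fun s => ENNReal.ofReal (2 * s)) s * c i := by
    intro s
    rw [← ENNReal.tsum_mul_left]
    refine (tsum_subtype {i | s ≤ φ i} (fun i => ENNReal.ofReal (2 * s) * c i)).trans ?_
    refine tsum_congr fun i => ?_
    by_cases h : s ≤ φ i <;> simp [h]
  simp_rw [key]
  rw [lintegral_tsum fun i => ((Measurable.indicator (by fun_prop)
    measurableSet_Iic).mul_const _).aemeasurable]
  refine tsum_congr fun i => ?_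
  rw [lintegral_mul_const _ (Measurable.indicator (by fun_prop) measurableSet_Iic),
    lintegral_indicator measurableSet_Iic, Measure.restrict_restrict measurableSet_Iic,
    Set.inter_comm, Set.Ioi_inter_Iic, setLIntegral_Ioc_two_mul (hφ i)]

/-- For `x > 0` the set is `s > x^(-γ)`, and integrating the power of `s` gives `x^(γβ) / β`; the
relation `γβ = p - 1` turns the remaining factor `x` into `x^p`. -/
theorem lintegral_indicator_superlevel_rpow {p γ β x : ℝ} (hβ : 0 < β)
    (hγβ : γ * β = p - 1) (hp : 0 < p) (hx : 0 ≤ x) :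
    ∫⁻ s in Set.Ioi 0, {s : ℝ | 1 < s * x ^ γ}.indicator
      (fun s => ENNReal.ofReal (s ^ (-1 - β)) * ENNReal.ofReal x) s =
      ENNReal.ofReal (1 / β) * ENNReal.ofReal (x ^ p) := by
  rcases hx.eq_or_lt with rfl | hx
  · simp [Real.zero_rpow hp.ne']
  have hxγ : 0 < x ^ γ := Real.rpow_pos_of_pos hx _
  have hset : {s : ℝ | 1 < s * x ^ γ} = Set.Ioi (x ^ (-γ)) := by
    ext s
    rw [Set.mem_ofPred_eq, Set.mem_Ioi, Real.rpow_neg hx.le, ← one_div, div_lt_iff₀ hxγ]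
  have hpos : 0 < x ^ (-γ) := Real.rpow_pos_of_pos hx _
  rw [hset, lintegral_indicator measurableSet_Ioi, Measure.restrict_restrict measurableSet_Ioi,
    Set.inter_eq_left.2 (Set.Ioi_subset_Ioi hpos.le), lintegral_mul_const _ (by fun_prop),
    setLIntegral_Ioi_rpow hpos hβ, ← ENNReal.ofReal_mul (by positivity),
    ← ENNReal.ofReal_mul (by positivity)]
  congr 1
  rw [← Real.rpow_mul hx.le, show -γ * -β = p - 1 by linarith, div_mul_eq_mul_div,
    ← Real.rpow_add_one hx.ne']
  ring_nf

theorem lintegral_indicator_sublevel_sq {p γ x : ℝ} (hγp : 2 * γ = 2 - p) (hp : 0 < p)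
    (hx : 0 ≤ x) :
    ∫⁻ s in Set.Ioi 0, {s : ℝ | 1 < s * x ^ γ}ᶜ.indicator
      (fun s => ENNReal.ofReal (2 * s) * ENNReal.ofReal x ^ 2) s = ENNReal.ofReal (x ^ p) := by
  rcases hx.eq_or_lt with rfl | hx
  · simp [Real.zero_rpow hp.ne']
  have hxγ : 0 < x ^ γ := Real.rpow_pos_of_pos hx _
  have hset : {s : ℝ | 1 < s * x ^ γ}ᶜ = Set.Iic (x ^ (-γ)) := by
    ext s
    rw [Set.mem_compl_iff, Set.mem_ofPred_eq, not_lt, Set.mem_Iic, Real.rpow_neg hx.le, ← one_div,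
      le_div_iff₀ hxγ]
  have hpos : 0 < x ^ (-γ) := Real.rpow_pos_of_pos hx _
  rw [hset, lintegral_indicator measurableSet_Iic, Measure.restrict_restrict measurableSet_Iic,
    Set.inter_comm, Set.Ioi_inter_Iic, lintegral_mul_const _ (by fun_prop),
    setLIntegral_Ioc_two_mul hpos.le, ← ENNReal.ofReal_pow hpos.le, ← ENNReal.ofReal_pow hx.le,
    ← ENNReal.ofReal_mul (by positivity)]
  congr 1
  rw [← Real.rpow_natCast, ← Real.rpow_natCast, ← Real.rpow_mul hx.le, ← Real.rpow_add hx]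
  congr 1
  push_cast
  linarith

/-- On this set `1 ≤ (s F^γ)^β = s^β F^(p-1)`, hence `F ≤ s^β F^p` pointwise. -/
theorem setLIntegral_superlevel_le {p γ β s : ℝ} (hβ : 0 < β) (hγβ : γ * β = p - 1) (hp : 1 < p)
    (hs : 0 < s) {F : α → ℝ} (hF : Measurable F) (hF0 : ∀ x, 0 ≤ F x)
    (hFp : ∫⁻ x, ENNReal.ofReal (F x ^ p) ∂μ ≤ 1) :
    ∫⁻ x in {x | 1 < s * F x ^ γ}, ENNReal.ofReal (F x) ∂μ ≤ ENNReal.ofReal (s ^ β) := by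
  have hm : MeasurableSet {x | 1 < s * F x ^ γ} := measurableSet_lt (by fun_prop) (by fun_prop)
  calc ∫⁻ x in {x | 1 < s * F x ^ γ}, ENNReal.ofReal (F x) ∂μ
      ≤ ∫⁻ x in {x | 1 < s * F x ^ γ}, ENNReal.ofReal (s ^ β) * ENNReal.ofReal (F x ^ p) ∂μ := by
        refine setLIntegral_mono' hm fun x hx => ?_
        rw [← ENNReal.ofReal_mul (by positivity)]
        refine ENNReal.ofReal_le_ofReal ?_
        have h1 : 1 ≤ (s * F x ^ γ) ^ β := Real.one_le_rpow (le_of_lt hx) hβ.le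
        rw [Real.mul_rpow hs.le (Real.rpow_nonneg (hF0 x) _), ← Real.rpow_mul (hF0 x), hγβ] at h1
        have h2 : F x ^ p = F x ^ (p - 1) * F x := by
          rcases (hF0 x).eq_or_lt with h0 | h0
          · rw [← h0, Real.zero_rpow (by linarith), mul_zero]
          · rw [← Real.rpow_add_one h0.ne', sub_add_cancel]
        rw [h2, ← mul_assoc]
        exact le_mul_of_one_le_left (hF0 x) h1
    _ ≤ ∫⁻ x, ENNReal.ofReal (s ^ β) * ENNReal.ofReal (F x ^ p) ∂μ := setLIntegral_le_lintegral _ _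
    _ = ENNReal.ofReal (s ^ β) * ∫⁻ x, ENNReal.ofReal (F x ^ p) ∂μ :=
        lintegral_const_mul _ (by fun_prop)
    _ ≤ ENNReal.ofReal (s ^ β) * 1 := by gcongr
    _ = _ := mul_one _

theorem lintegral_level_split_le [SFinite μ] {p : ℝ} (hp : 1 < p) (hp2 : p < 2) {F : α → ℝ}
    (hF : Measurable F) (hF0 : ∀ x, 0 ≤ F x) (hFp : ∫⁻ x, ENNReal.ofReal (F x ^ p) ∂μ ≤ 1) :
    ∫⁻ s in Set.Ioi (0 : ℝ), ENNReal.ofReal (2 * s) *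
      (2 * (ENNReal.ofReal (s ^ (-(2 * p / (2 - p)))) *
          (∫⁻ x in {x | 1 < s * F x ^ ((2 - p) / 2)}, ENNReal.ofReal (F x) ∂μ) ^ 2) +
        2 * ∫⁻ x in {x | 1 < s * F x ^ ((2 - p) / 2)}ᶜ, ENNReal.ofReal (F x) ^ 2 ∂μ) ≤
      ENNReal.ofReal (2 / (p - 1)) := by
  -- `γ` is forced by the small part, which integrates to `F^(2-2γ)`, and `β` by the large part,
  -- which gives `F^(1+γβ)`; both must equal `F^p`.
  set γ : ℝ := (2 - p) / 2 with hγ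
  set β : ℝ := (p - 1) / γ with hβ
  have hγ0 : 0 < γ := by rw [hγ]; linarith
  have hp1 : 0 < p - 1 := by linarith
  have h2p : 0 < 2 - p := by linarith
  have hβ0 : 0 < β := div_pos hp1 hγ0
  have hγβ : γ * β = p - 1 := mul_div_cancel₀ _ hγ0.ne'
  have hexp : 1 + -(2 * p / (2 - p)) + β = -1 - β := by
    rw [hβ, hγ]; field_simp; ring
  have hm : ∀ s : ℝ, MeasurableSet {x | 1 < s * F x ^ γ} := fun s =>
    measurableSet_lt (by fun_prop) (by fun_prop)
  have hmF : Measurable fun z : ℝ × α => F z.2 := hF.comp measurable_snd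
  have hM : MeasurableSet {z : ℝ × α | 1 < z.1 * F z.2 ^ γ} :=
    measurableSet_lt (by fun_prop) (by fun_prop)
  set K₁ : ℝ → α → ℝ≥0∞ := fun s x => {x | 1 < s * F x ^ γ}.indicator
    (fun x => ENNReal.ofReal (s ^ (-1 - β)) * ENNReal.ofReal (F x)) x with hK₁
  set K₂ : ℝ → α → ℝ≥0∞ := fun s x => {x | 1 < s * F x ^ γ}ᶜ.indicator
    (fun x => ENNReal.ofReal (2 * s) * ENNReal.ofReal (F x) ^ 2) x with hK₂
  have hK₁m : Measurable (Function.uncurry K₁) := by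
    have : Function.uncurry K₁ = {z : ℝ × α | 1 < z.1 * F z.2 ^ γ}.indicator
        (fun z => ENNReal.ofReal (z.1 ^ (-1 - β)) * ENNReal.ofReal (F z.2)) := by
      ext ⟨s, x⟩
      simp [hK₁, Set.indicator]
    rw [this]
    exact Measurable.indicator (by fun_prop) hM
  have hK₂m : Measurable (Function.uncurry K₂) := by
    have : Function.uncurry K₂ = {z : ℝ × α | 1 < z.1 * F z.2 ^ γ}ᶜ.indicator
        (fun z => ENNReal.ofReal (2 * z.1) * ENNReal.ofReal (F z.2) ^ 2) := by
      ext ⟨s, x⟩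
      simp [hK₂, Set.indicator]
    rw [this]
    exact Measurable.indicator (by fun_prop) hM.compl
  have hbound : ∀ s ∈ Set.Ioi (0 : ℝ), ENNReal.ofReal (2 * s) *
      (2 * (ENNReal.ofReal (s ^ (-(2 * p / (2 - p)))) *
          (∫⁻ x in {x | 1 < s * F x ^ γ}, ENNReal.ofReal (F x) ∂μ) ^ 2) +
        2 * ∫⁻ x in {x | 1 < s * F x ^ γ}ᶜ, ENNReal.ofReal (F x) ^ 2 ∂μ) ≤
      4 * (∫⁻ x, K₁ s x ∂μ) + 2 * ∫⁻ x, K₂ s x ∂μ := by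
    intro s hs
    have hs : 0 < s := hs
    have hG := setLIntegral_superlevel_le hβ0 hγβ hp hs hF hF0 hFp
    rw [mul_add]
    gcongr ?_ + ?_
    -- One factor of the squared integral is replaced by its bound `s^β`; the other stays, so that
    -- the expression is linear in `F` and Tonelli applies.
    · rw [hK₁, lintegral_indicator (hm s), lintegral_const_mul _ (by fun_prop), sq, ← hexp,
        Real.rpow_add hs, Real.rpow_add hs, Real.rpow_one, ENNReal.ofReal_mul (by positivity),
        ENNReal.ofReal_mul (by positivity), ENNReal.ofReal_mul (by positivity),
        show ENNReal.ofReal 2 = 2 by simp]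
      calc _ = 4 * (ENNReal.ofReal s * ENNReal.ofReal (s ^ (-(2 * p / (2 - p)))) *
            (∫⁻ x in {x | 1 < s * F x ^ γ}, ENNReal.ofReal (F x) ∂μ) *
            ∫⁻ x in {x | 1 < s * F x ^ γ}, ENNReal.ofReal (F x) ∂μ) := by ring
        _ ≤ _ := by gcongr
    · rw [hK₂, lintegral_indicator (hm s).compl, lintegral_const_mul _ (by fun_prop)]
      exact le_of_eq (by ring)
  calc _ ≤ ∫⁻ s in Set.Ioi (0 : ℝ), (4 * (∫⁻ x, K₁ s x ∂μ) + 2 * ∫⁻ x, K₂ s x ∂μ) :=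
        setLIntegral_mono' measurableSet_Ioi hbound
    _ = 4 * (∫⁻ s in Set.Ioi (0 : ℝ), ∫⁻ x, K₁ s x ∂μ) +
          2 * ∫⁻ s in Set.Ioi (0 : ℝ), ∫⁻ x, K₂ s x ∂μ := by
        have h₁ : Measurable fun s => ∫⁻ x, K₁ s x ∂μ := hK₁m.lintegral_prod_right'
        have h₂ : Measurable fun s => ∫⁻ x, K₂ s x ∂μ := hK₂m.lintegral_prod_right'
        rw [lintegral_add_left (h₁.const_mul _), lintegral_const_mul _ h₁,
          lintegral_const_mul _ h₂]
    _ = 4 * (ENNReal.ofReal (1 / β) * ∫⁻ x, ENNReal.ofReal (F x ^ p) ∂μ) +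
          2 * ∫⁻ x, ENNReal.ofReal (F x ^ p) ∂μ := by
        have h₁ : ∀ x, ∫⁻ s in Set.Ioi 0, K₁ s x =
            ENNReal.ofReal (1 / β) * ENNReal.ofReal (F x ^ p) := fun x =>
          lintegral_indicator_superlevel_rpow hβ0 hγβ (by linarith) (hF0 x)
        have h₂ : ∀ x, ∫⁻ s in Set.Ioi 0, K₂ s x = ENNReal.ofReal (F x ^ p) := fun x =>
          lintegral_indicator_sublevel_sq (by rw [hγ]; ring) (by linarith) (hF0 x)
        rw [lintegral_lintegral_swap hK₁m.aemeasurable, lintegral_lintegral_swap hK₂m.aemeasurable]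
        simp_rw [h₁, h₂]
        rw [lintegral_const_mul _ (by fun_prop)]
    _ ≤ 4 * (ENNReal.ofReal (1 / β) * 1) + 2 * 1 := by gcongr
    -- `4/β + 2 = 2(2-p)/(p-1) + 2`.
    _ = ENNReal.ofReal (2 / (p - 1)) := by
        rw [mul_one, mul_one, show (4 : ℝ≥0∞) = ENNReal.ofReal 4 by simp,
          show (2 : ℝ≥0∞) = ENNReal.ofReal 2 by simp, ← ENNReal.ofReal_mul (by norm_num),
          ← ENNReal.ofReal_add (by positivity) (by norm_num)]
        congr 1
        rw [hβ, hγ]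
        field_simp
        ring

/-! ### The Paley-type inequality. -/

/-- A Paley-type inequality, normalized. -/
theorem tsum_ofReal_sq_mul_enorm_inner_sq_le_of_le_one [SFinite μ] {ι : Type*} [Countable ι]
    {v : ι → Lp ℂ 2 μ} (hv : Orthonormal ℂ v) {p : ℝ} (hp : 1 < p) (hp2 : p < 2)
    {φ : ι → ℝ} (hφ : ∀ i, 0 ≤ φ i)
    (hN : ∀ s, 0 < s → ∑' i : {i // s ≤ φ i}, eLpNorm (v i) ∞ μ ^ 2 ≤
      ENNReal.ofReal (s ^ (-(2 * p / (2 - p)))))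
    (f : Lp ℂ 2 μ) (hf : ∫⁻ x, ‖f x‖ₑ ^ p ∂μ ≤ 1) :
    ∑' i, ENNReal.ofReal (φ i) ^ 2 * ‖inner ℂ (v i) f‖ₑ ^ 2 ≤ ENNReal.ofReal (2 / (p - 1)) := by
  have hfm : Measurable fun x => ‖f x‖ := (Lp.stronglyMeasurable f).norm.measurable
  refine le_trans ?_ (lintegral_level_split_le (μ := μ) hp hp2 hfm (fun x => norm_nonneg _) ?_)
  · rw [tsum_ofReal_sq_mul_eq_lintegral hφ]
    refine setLIntegral_mono' measurableSet_Ioi fun s hs => ?_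
    gcongr ENNReal.ofReal (2 * s) * ?_
    have hm : MeasurableSet {x | 1 < s * ‖f x‖ ^ ((2 - p) / 2)} :=
      measurableSet_lt (by fun_prop) (by fun_prop)
    refine (tsum_enorm_inner_sq_le_of_measurableSet
      (hv.comp _ (Subtype.val_injective (p := fun i => s ≤ φ i))) f hm).trans ?_
    simp only [ofReal_norm]
    gcongr
    exact hN s hs
  · refine le_trans (le_of_eq ?_) hf
    refine lintegral_congr fun x => ?_
    rw [← ofReal_norm, ENNReal.ofReal_rpow_of_nonneg (norm_nonneg _) (by linarith)]

/-- A Paley-type inequality: a weight of weak type with respect to `‖v i‖_∞ ^ 2` maps the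
coefficients of `L^p` functions to `ℓ²`. -/
theorem tsum_ofReal_sq_mul_enorm_inner_sq_le [SFinite μ] {ι : Type*} [Countable ι]
    {v : ι → Lp ℂ 2 μ} (hv : Orthonormal ℂ v) {p : ℝ} (hp : 1 < p) (hp2 : p ≤ 2)
    {φ : ι → ℝ} (hφ : ∀ i, 0 ≤ φ i) {B : ℝ} (hB : 0 < B)
    (hN : ∀ s, 0 < s → (∃ i, s ≤ φ i) → ENNReal.ofReal s *
      (∑' i : {i // s ≤ φ i}, eLpNorm (v i) ∞ μ ^ 2) ^ (1 / p - 1 / 2) ≤ ENNReal.ofReal B)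
    (f : Lp ℂ 2 μ) :
    ∑' i, ENNReal.ofReal (φ i) ^ 2 * ‖inner ℂ (v i) f‖ₑ ^ 2 ≤
      ENNReal.ofReal (2 / (p - 1)) *
        (ENNReal.ofReal B * eLpNorm f (ENNReal.ofReal p) μ) ^ 2 := by
  have hp0 : 0 < p := by linarith
  have hp1 : 0 < p - 1 := by linarith
  rcases hp2.eq_or_lt with rfl | hp2
  -- At `p = 2` the exponent in `hN` vanishes, so `hN` at level `φ i` says `φ i ≤ B` and Bessel
  -- suffices. Nonempty levels only are required in `hN` because an empty sum to the power `0` is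
  -- `1`.
  · have hle : ∀ i, φ i ≤ B := by
      intro i
      rcases (hφ i).eq_or_lt with h0 | h0
      · rw [← h0]; exact hB.le
      · have := hN (φ i) h0 ⟨i, le_rfl⟩
        rw [sub_self, ENNReal.rpow_zero, mul_one] at this
        exact (ENNReal.ofReal_le_ofReal_iff hB.le).1 this
    calc ∑' i, ENNReal.ofReal (φ i) ^ 2 * ‖inner ℂ (v i) f‖ₑ ^ 2
        ≤ ∑' i, ENNReal.ofReal B ^ 2 * ‖inner ℂ (v i) f‖ₑ ^ 2 := by
          refine ENNReal.tsum_le_tsum fun i => ?_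
          gcongr
          exact hle i
      _ ≤ 1 * (ENNReal.ofReal B ^ 2 * ‖f‖ₑ ^ 2) := by
          rw [ENNReal.tsum_mul_left, one_mul]
          gcongr
          exact tsum_enorm_inner_sq_le hv f
      _ ≤ _ := by
          rw [mul_pow, show ENNReal.ofReal 2 = 2 by simp, ← Lp.enorm_def]
          gcongr
          rw [ENNReal.one_le_ofReal]
          norm_num
  have h2p : 0 < 2 - p := by linarith
  have hpE : ENNReal.ofReal p ≠ 0 := by simpa using hp0
  rcases eq_or_ne (eLpNorm f (ENNReal.ofReal p) μ) ∞ with hF | hF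
  · rw [hF, ENNReal.mul_top (by simpa using hB), ENNReal.top_pow two_ne_zero,
      ENNReal.mul_top (ENNReal.ofReal_pos.2 (by positivity)).ne']
    exact le_top
  rcases eq_or_ne (eLpNorm f (ENNReal.ofReal p) μ) 0 with hF0 | hF0
  · have h0 : f = 0 := by
      rw [eLpNorm_eq_zero_iff (Lp.aestronglyMeasurable f) hpE] at hF0
      exact (Lp.eq_zero_iff_ae_eq_zero).2 hF0
    simp [h0]
  set F : ℝ := (eLpNorm f (ENNReal.ofReal p) μ).toReal
  have hFpos : 0 < F := ENNReal.toReal_pos hF0 hF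
  have hFe : eLpNorm f (ENNReal.ofReal p) μ = ENNReal.ofReal F :=
    (ENNReal.ofReal_toReal hF).symm
  -- Dividing the weight by `B` and solving for the sum, which is possible as `1/p - 1/2 > 0`, gives
  -- the normalized hypothesis.
  have hN' : ∀ s, 0 < s → ∑' i : {i // s ≤ φ i / B}, eLpNorm (v i) ∞ μ ^ 2 ≤
      ENNReal.ofReal (s ^ (-(2 * p / (2 - p)))) := by
    intro s hs
    by_cases hex : ∃ i, s ≤ φ i / B
    · have hiff : ∀ i, s * B ≤ φ i ↔ s ≤ φ i / B := fun i => (le_div_iff₀ hB).symm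
      have h := hN (s * B) (by positivity) (by simpa only [hiff] using hex)
      rw [← (Equiv.subtypeEquivRight hiff).symm.tsum_eq
        fun i : {i // s * B ≤ φ i} => eLpNorm (v i) ∞ μ ^ 2] at h
      simp only [Equiv.subtypeEquivRight_symm_apply_coe] at h
      set N := ∑' i : {i // s ≤ φ i / B}, eLpNorm (v i) ∞ μ ^ 2
      have ha : 0 < 1 / p - 1 / 2 := by
        rw [sub_pos]
        exact one_div_lt_one_div_of_lt hp0 hp2
      have h1 : N ^ (1 / p - 1 / 2) ≤ ENNReal.ofReal (s⁻¹) := by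
        rw [ENNReal.ofReal_inv_of_pos hs, ENNReal.le_inv_iff_mul_le]
        have hB0 : ENNReal.ofReal B ≠ 0 := by simpa using hB
        rw [← ENNReal.mul_le_mul_iff_left hB0 ENNReal.ofReal_ne_top, one_mul]
        refine le_trans (le_of_eq ?_) h
        rw [ENNReal.ofReal_mul hs.le]
        ring
      have h2 : N ≤ ENNReal.ofReal (s⁻¹) ^ (1 / p - 1 / 2)⁻¹ := by
        rw [ENNReal.le_rpow_inv_iff ha]
        exact h1
      refine h2.trans (le_of_eq ?_)
      rw [ENNReal.ofReal_rpow_of_pos (by positivity), Real.inv_rpow hs.le, ← Real.rpow_neg hs.le]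
      congr 3
      field_simp
    · have : IsEmpty {i // s ≤ φ i / B} := ⟨fun i => hex ⟨i.1, i.2⟩⟩
      simp
  have hf' : ∫⁻ x, ‖(((F⁻¹ : ℝ) : ℂ) • f : Lp ℂ 2 μ) x‖ₑ ^ p ∂μ ≤ 1 := by
    have hnorm : eLpNorm (((F⁻¹ : ℝ) : ℂ) • f : Lp ℂ 2 μ) (ENNReal.ofReal p) μ = 1 := by
      rw [eLpNorm_congr_ae (Lp.coeFn_smul _ _), eLpNorm_const_smul, hFe, ← ofReal_norm,
        ← ENNReal.ofReal_mul (by positivity)]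
      rw [Complex.norm_real, Real.norm_of_nonneg (by positivity), inv_mul_cancel₀ hFpos.ne',
        ENNReal.ofReal_one]
    rw [eLpNorm_eq_lintegral_rpow_enorm_toReal hpE ENNReal.ofReal_ne_top,
      ENNReal.toReal_ofReal hp0.le, one_div] at hnorm
    exact (ENNReal.rpow_inv_le_iff hp0).1 hnorm.le |>.trans (ENNReal.one_rpow p).le
  have h := tsum_ofReal_sq_mul_enorm_inner_sq_le_of_le_one hv hp hp2
    (fun i => div_nonneg (hφ i) hB.le) hN' _ hf'
  have hscale : ∀ i, ENNReal.ofReal (φ i) ^ 2 * ‖inner ℂ (v i) f‖ₑ ^ 2 =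
      (ENNReal.ofReal B * ENNReal.ofReal F) ^ 2 * (ENNReal.ofReal (φ i / B) ^ 2 *
        ‖inner ℂ (v i) (((F⁻¹ : ℝ) : ℂ) • f)‖ₑ ^ 2) := by
    intro i
    have h1 : ENNReal.ofReal (φ i) = ENNReal.ofReal B * ENNReal.ofReal (φ i / B) := by
      rw [← ENNReal.ofReal_mul hB.le, mul_div_cancel₀ _ hB.ne']
    have h2 : ‖inner ℂ (v i) f‖ₑ =
        ENNReal.ofReal F * ‖inner ℂ (v i) (((F⁻¹ : ℝ) : ℂ) • f)‖ₑ := by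
      rw [inner_smul_right, enorm_mul, ← mul_assoc, ← ofReal_norm (((F⁻¹ : ℝ) : ℂ)),
        ← ENNReal.ofReal_mul hFpos.le, Complex.norm_real, Real.norm_of_nonneg (by positivity),
        mul_inv_cancel₀ hFpos.ne', ENNReal.ofReal_one, one_mul]
    rw [h1, h2]
    ring
  simp_rw [hscale]
  rw [ENNReal.tsum_mul_left, hFe, mul_comm]
  gcongr

/-! ### Duality for the `L^q` norm. -/

/-- The `L^q` norm of an `L²` function is determined by pairing with `L²` functions. -/
theorem eLpNorm_le_of_enorm_inner_le {p q : ℝ} (hpq : p.HolderConjugate q) (hq2 : 2 ≤ q)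
    (f : Lp ℂ 2 μ) {M : ℝ≥0∞}
    (hM : ∀ g : Lp ℂ 2 μ, ‖inner ℂ g f‖ₑ ≤ M * eLpNorm g (ENNReal.ofReal p) μ) :
    eLpNorm f (ENNReal.ofReal q) μ ≤ M := by
  have hq0 : 0 < q := by linarith
  have hp0 : 0 < p := hpq.pos
  have hfm : Measurable fun x => ‖f x‖ := (Lp.stronglyMeasurable f).norm.measurable
  have hfm' : Measurable f := (Lp.stronglyMeasurable f).measurable
  set S : ℕ → Set α := fun N => {x | ‖f x‖ ≤ N}
  have hS : ∀ N, MeasurableSet (S N) := fun N => measurableSet_le hfm measurable_const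
  have hUnion : ⋃ N, S N = Set.univ := by
    refine Set.eq_univ_of_forall fun x => Set.mem_iUnion.2 ?_
    exact exists_nat_ge ‖f x‖
  have hdir : Directed (· ⊆ ·) S := by
    refine Monotone.directed_le fun a b hab x hx => ?_
    exact le_trans (show ‖f x‖ ≤ a from hx) (by exact_mod_cast hab)
  rw [eLpNorm_eq_lintegral_rpow_enorm_toReal (by simpa using hq0) ENNReal.ofReal_ne_top,
    ENNReal.toReal_ofReal hq0.le, one_div, ENNReal.rpow_inv_le_iff hq0, ← setLIntegral_univ,
    ← hUnion, setLIntegral_iUnion_of_directed _ hdir]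
  refine iSup_le fun N => ?_
  rw [← ENNReal.rpow_inv_le_iff hq0]
  set I := ∫⁻ x in S N, ‖f x‖ₑ ^ q ∂μ with hI
  -- The usual extremal function, truncated to `|f| ≤ N`. As `q ≥ 2`, it is at most `N^(q-2) |f|`,
  -- hence lies in `L²`. Its pairing with `f` is `I`, and its `L^p` norm is `I^(1/p)` because
  -- `(q-1)p = q`; dividing `I ≤ M I^(1/p)` by the finite `I^(1/p)` gives the claim.
  set g₀ : α → ℂ := (S N).indicator fun x => ((‖f x‖ ^ (q - 2) : ℝ) : ℂ) * f x with hg₀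
  have hg₀m : Measurable g₀ := Measurable.indicator (by fun_prop) (hS N)
  have hg₀L : MemLp g₀ 2 μ := by
    refine (Lp.memLp f).of_le_mul (c := (N : ℝ) ^ (q - 2)) hg₀m.aestronglyMeasurable
      (Filter.Eventually.of_forall fun x => ?_)
    by_cases hx : x ∈ S N
    · rw [hg₀, Set.indicator_of_mem hx, norm_mul, Complex.norm_real,
        Real.norm_of_nonneg (by positivity)]
      have hx' : ‖f x‖ ≤ N := hx
      gcongr
    · rw [hg₀, Set.indicator_of_notMem hx, norm_zero]
      positivity
  have hinner : ‖inner ℂ (hg₀L.toLp g₀) f‖ₑ = I := by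
    have h1 : inner ℂ (hg₀L.toLp g₀) f =
        ((∫ x, (S N).indicator (fun x => ‖f x‖ ^ q) x ∂μ : ℝ) : ℂ) := by
      rw [L2.inner_def, ← integral_complex_ofReal]
      refine integral_congr_ae ?_
      filter_upwards [hg₀L.coeFn_toLp] with x hx
      rw [hx, hg₀]
      by_cases hxS : x ∈ S N
      · rw [Set.indicator_of_mem hxS, Set.indicator_of_mem hxS, RCLike.inner_apply, map_mul,
          Complex.conj_ofReal, mul_left_comm, Complex.mul_conj, Complex.normSq_eq_norm_sq,
          ← Complex.ofReal_mul]
        congr 1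
        rcases (norm_nonneg (f x)).eq_or_lt with h0 | h0
        · rw [← h0, Real.zero_rpow hq0.ne']; simp
        · rw [← Real.rpow_natCast, ← Real.rpow_add h0]
          congr 1
          push_cast
          ring
      · simp [hxS]
    have h2 : 0 ≤ ∫ x, (S N).indicator (fun x => ‖f x‖ ^ q) x ∂μ :=
      integral_nonneg fun x => Set.indicator_nonneg (fun x _ => by positivity) x
    rw [h1, ← ofReal_norm, Complex.norm_real, Real.norm_of_nonneg h2, hI,
      ← lintegral_indicator (hS N), integral_eq_lintegral_of_nonneg_ae
        (Filter.Eventually.of_forall fun x => Set.indicator_nonneg (fun x _ => by positivity) x)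
        (Measurable.indicator (by fun_prop) (hS N)).aestronglyMeasurable, ENNReal.ofReal_toReal]
    · refine lintegral_congr fun x => ?_
      by_cases hxS : x ∈ S N
      · simp only [Set.indicator_of_mem hxS]
        rw [← ofReal_norm, ENNReal.ofReal_rpow_of_nonneg (norm_nonneg _) hq0.le]
      · simp [hxS]
    · have h3 : ∫⁻ x, ENNReal.ofReal ((S N).indicator (fun x => ‖f x‖ ^ q) x) ∂μ ≤
          ∫⁻ x, ENNReal.ofReal ((N : ℝ) ^ (q - 2)) * ‖f x‖ₑ ^ 2 ∂μ := by
        refine lintegral_mono fun x => ?_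
        by_cases hxS : x ∈ S N
        · simp only [Set.indicator_of_mem hxS]
          rw [← ofReal_norm, ← ENNReal.ofReal_pow (norm_nonneg _),
            ← ENNReal.ofReal_mul (by positivity)]
          refine ENNReal.ofReal_le_ofReal ?_
          have h4 : ‖f x‖ ^ q = ‖f x‖ ^ (q - 2) * ‖f x‖ ^ 2 := by
            rcases (norm_nonneg (f x)).eq_or_lt with h0 | h0
            · rw [← h0, Real.zero_rpow hq0.ne']; simp
            · rw [← Real.rpow_natCast, ← Real.rpow_add h0]
              congr 1
              push_cast
              ring
          have hx' : ‖f x‖ ≤ N := hxS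
          rw [h4]
          gcongr
        · simp [hxS]
      refine ne_top_of_le_ne_top ?_ h3
      rw [lintegral_const_mul _ (by fun_prop), ← enorm_sq_eq_lintegral]
      exact ENNReal.mul_ne_top ENNReal.ofReal_ne_top (ENNReal.pow_ne_top enorm_ne_top)
  have hIfin : I ≠ ∞ := hinner ▸ enorm_ne_top
  have hgnorm : eLpNorm (hg₀L.toLp g₀) (ENNReal.ofReal p) μ = I ^ (1 / p) := by
    rw [eLpNorm_congr_ae hg₀L.coeFn_toLp, eLpNorm_eq_lintegral_rpow_enorm_toReal
      (by simpa using hp0) ENNReal.ofReal_ne_top, ENNReal.toReal_ofReal hp0.le, hI,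
      ← lintegral_indicator (hS N)]
    congr 1
    refine lintegral_congr fun x => ?_
    by_cases hxS : x ∈ S N
    · rw [hg₀, Set.indicator_of_mem hxS, Set.indicator_of_mem hxS, ← ofReal_norm, ← ofReal_norm,
        ENNReal.ofReal_rpow_of_nonneg (norm_nonneg _) hp0.le,
        ENNReal.ofReal_rpow_of_nonneg (norm_nonneg _) hq0.le, norm_mul, Complex.norm_real,
        Real.norm_of_nonneg (by positivity)]
      congr 1
      rcases (norm_nonneg (f x)).eq_or_lt with h0 | h0
      · rw [← h0, Real.zero_rpow hq0.ne', mul_zero, Real.zero_rpow hp0.ne']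
      · rw [← Real.rpow_add_one h0.ne', ← Real.rpow_mul h0.le]
        congr 1
        have := hpq.mul_eq_add
        linarith
    · simp [hg₀, hxS, hp0]
  have hfin := hM (hg₀L.toLp g₀)
  rw [hinner, hgnorm] at hfin
  rcases eq_or_ne I 0 with h0 | h0
  · rw [h0, ENNReal.zero_rpow_of_pos (by positivity)]
    exact zero_le
  have hIp0 : I ^ (1 / p) ≠ 0 := by
    rw [Ne, ENNReal.rpow_eq_zero_iff_of_pos (by positivity)]; exact h0
  have hIpt : I ^ (1 / p) ≠ ∞ := ENNReal.rpow_ne_top_of_nonneg (by positivity) hIfin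
  rw [← ENNReal.mul_le_mul_iff_left hIp0 hIpt]
  refine le_trans (le_of_eq ?_) hfin
  rw [← ENNReal.rpow_add _ _ h0 hIfin]
  have := hpq.inv_add_inv_eq_one
  rw [show q⁻¹ + 1 / p = 1 by rw [one_div]; linarith, ENNReal.rpow_one]

end

/-! ### Schwartz functions as smooth vectors. -/

/-- The anharmonic oscillator acting on Schwartz functions. -/
noncomputable def schwartzOscillator (n k l : ℕ) (g : 𝓢(EuclideanSpace ℝ (Fin n), ℂ)) :
    𝓢(EuclideanSpace ℝ (Fin n), ℂ) :=
  (fun h : 𝓢(EuclideanSpace ℝ (Fin n), ℂ) => -(Δ h))^[l] g +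
    SchwartzMap.smulLeftCLM ℂ
      (fun x : EuclideanSpace ℝ (Fin n) => ((‖x‖ ^ (2 * k) : ℝ) : ℂ)) g + g

theorem negLaplacian_iterate_apply {n : ℕ} (l : ℕ) (T : 𝓢'(EuclideanSpace ℝ (Fin n), ℂ))
    (g : 𝓢(EuclideanSpace ℝ (Fin n), ℂ)) :
    ((negLaplacian n)^[l] T) g =
      T ((fun h : 𝓢(EuclideanSpace ℝ (Fin n), ℂ) => -(Δ h))^[l] g) := by
  induction l generalizing g with
  | zero => rfl
  | succ l ih =>
    rw [Function.iterate_succ_apply', Function.iterate_succ_apply, ← ih, map_neg]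
    change -((Δ ((negLaplacian n)^[l] T)) g) = _
    rw [TemperedDistribution.laplacian_apply_apply]

theorem oscillator_apply {n k l : ℕ} (T : 𝓢'(EuclideanSpace ℝ (Fin n), ℂ))
    (g : 𝓢(EuclideanSpace ℝ (Fin n), ℂ)) :
    oscillator n k l T g = T (schwartzOscillator n k l g) := by
  rw [schwartzOscillator, map_add, map_add, ← negLaplacian_iterate_apply,
    ← TemperedDistribution.smulLeftCLM_apply_apply]
  rfl

/-- The distributional pairing is bilinear and the inner product sesquilinear, whence the conjugate
of `g`, here and in the density statements. -/
theorem toTemperedDistribution_apply_eq_inner {n : ℕ} (v : L2 n)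
    (g : 𝓢(EuclideanSpace ℝ (Fin n), ℂ)) :
    Lp.toTemperedDistribution v g = inner ℂ (star (g.toLp 2 volume) : L2 n) v := by
  rw [Lp.toTemperedDistribution_apply, L2.inner_def]
  refine integral_congr_ae ?_
  filter_upwards [Lp.coeFn_star (g.toLp 2 volume : L2 n), g.coeFn_toLp 2 volume] with x h1 h2
  rw [h1, Pi.star_apply, h2, RCLike.inner_apply, smul_eq_mul, mul_comm]
  simp

/-- Moving `m` copies of the oscillator onto `g` shows that `lam j ^ m` times the `j`-th coefficient
is a coefficient of another Schwartz function. That function is in `L²`, so Bessel gives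
summability. -/
theorem star_toLp_mem_smoothVectors {n k l : ℕ} {u : HilbertBasis ℕ ℂ (L2 n)} {lam : ℕ → ℝ}
    (h : IsEigenbasis n k l u lam) (g : 𝓢(EuclideanSpace ℝ (Fin n), ℂ)) :
    (star (g.toLp 2 volume) : L2 n) ∈ smoothVectors u lam := by
  have hT : ∀ j (m : ℕ), Lp.toTemperedDistribution (u j) ((schwartzOscillator n k l)^[m] g) =
      (lam j : ℂ) ^ m * Lp.toTemperedDistribution (u j) g := by
    intro j m
    induction m with
    | zero => simp
    | succ m ih =>
      rw [Function.iterate_succ_apply', ← oscillator_apply, h j, pow_succ', mul_assoc, ← ih]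
      rfl
  refine Set.mem_iInter₂.2 fun m _ => ?_
  change Summable _
  convert u.orthonormal.inner_products_summable
    (star (((schwartzOscillator n k l)^[m] g).toLp 2 volume) : L2 n) using 2 with j
  rw [norm_inner_symm, ← toTemperedDistribution_apply_eq_inner, norm_inner_symm,
    ← toTemperedDistribution_apply_eq_inner, hT, norm_mul, mul_pow, norm_pow, Complex.norm_real,
    ← pow_mul, mul_comm m 2, Real.norm_eq_abs, (even_two_mul m).pow_abs]

theorem denseRange_star_toLp (n : ℕ) {p : ℝ≥0∞} [Fact (1 ≤ p)] (hp : p ≠ ∞) :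
    DenseRange fun g : 𝓢(EuclideanSpace ℝ (Fin n), ℂ) =>
      (star (g.toLp p volume) : Lp ℂ p (volume : Measure (EuclideanSpace ℝ (Fin n)))) := by
  have hiso : Isometry
      (star : Lp ℂ p (volume : Measure (EuclideanSpace ℝ (Fin n))) → Lp ℂ p volume) := by
    refine Isometry.of_dist_eq fun f g => ?_
    rw [dist_eq_norm, dist_eq_norm, Lp.norm_def, Lp.norm_def]
    congr 1
    rw [← eLpNorm_star (f := ((f - g : Lp ℂ p volume) : EuclideanSpace ℝ (Fin n) → ℂ))]
    refine eLpNorm_congr_ae ?_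
    filter_upwards [Lp.coeFn_star f, Lp.coeFn_star g, Lp.coeFn_sub f g,
      Lp.coeFn_sub (star f) (star g)] with x h1 h2 h3 h4
    rw [h4, Pi.star_apply, h3, Pi.sub_apply, Pi.sub_apply, h1, h2, Pi.star_apply, Pi.star_apply,
      star_sub]
  exact star_involutive.surjective.denseRange.comp
    (SchwartzMap.denseRange_toLpCLM (F := ℂ) (μ := volume) hp) hiso.continuous

theorem oscFourier_eq_inner {n : ℕ} (u : HilbertBasis ℕ ℂ (L2 n)) (f : L2 n) (j : ℕ) :
    oscFourier u f j = inner ℂ (u j) f := by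
  rw [L2.inner_def]
  rfl

/-! ### The multiplier bound. -/

/-- For `a > 0`, take the bound on `σ` at level `s^(1/a)` and raise it to the power `a`. For `a = 0`
the weight is the constant `1`, also where `σ` vanishes, and the bound reads `s ≤ 1`. -/
theorem ofReal_mul_tsum_rpow_le {n : ℕ} {u : HilbertBasis ℕ ℂ (L2 n)} {σ : ℕ → ℂ} {c a B : ℝ}
    (hB : 0 < B) (ha : 0 ≤ a) (h : symbolBound u σ c ≤ ENNReal.ofReal B) {s : ℝ} (hs : 0 < s)
    (hex : ∃ j, s ≤ ‖σ j‖ ^ a) :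
    ENNReal.ofReal s * (∑' j : {j // s ≤ ‖σ j‖ ^ a}, eLpNorm (u j) ∞ volume ^ 2) ^ (a * c) ≤
      ENNReal.ofReal (B ^ a) := by
  rcases ha.eq_or_lt with rfl | ha
  · obtain ⟨j, hj⟩ := hex
    rw [zero_mul, ENNReal.rpow_zero, mul_one, Real.rpow_zero]
    rw [Real.rpow_zero] at hj
    exact ENNReal.ofReal_le_ofReal hj
  · have hiff : ∀ j, s ≤ ‖σ j‖ ^ a ↔ s ^ a⁻¹ ≤ ‖σ j‖ := fun j =>
      (Real.rpow_inv_le_iff_of_pos hs.le (norm_nonneg _) ha).symm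
    have hex' : ∃ j, s ^ a⁻¹ ≤ ‖σ j‖ := by simpa only [hiff] using hex
    have h1 : ENNReal.ofReal (s ^ a⁻¹) *
        (∑' j : {j : ℕ // s ^ a⁻¹ ≤ ‖σ j‖}, eLpNorm (u j) ∞ volume ^ 2) ^ c ≤
          ENNReal.ofReal B := by
      simp only [symbolBound, iSup_le_iff] at h
      exact h _ (Real.rpow_pos_of_pos hs _) hex'
    have h2 := ENNReal.rpow_le_rpow h1 ha.le
    rw [← (Equiv.subtypeEquivRight hiff).tsum_eq
      fun j : {j : ℕ // s ^ a⁻¹ ≤ ‖σ j‖} => eLpNorm (u j) ∞ volume ^ 2,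
      ENNReal.mul_rpow_of_nonneg _ _ ha.le, ← ENNReal.rpow_mul, mul_comm c a,
      ENNReal.ofReal_rpow_of_pos (Real.rpow_pos_of_pos hs _), ENNReal.ofReal_rpow_of_pos hB,
      ← Real.rpow_mul hs.le, inv_mul_cancel₀ ha.ne', Real.rpow_one] at h2
    exact h2

/-- These are the exponents in the splitting of `|σ|`. The degenerate case `a + b = 0` is `p = q =
2`, where any convex weights serve. -/
theorem exists_convex_weights {a b : ℝ} (ha : 0 ≤ a) (hb : 0 ≤ b) :
    ∃ s t : ℝ, 0 ≤ s ∧ 0 ≤ t ∧ s + t = 1 ∧ s * (a + b) = a ∧ t * (a + b) = b := by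
  rcases (add_nonneg ha hb).eq_or_lt with h | h
  · exact ⟨1, 0, zero_le_one, le_rfl, add_zero 1, by linarith, by linarith⟩
  · exact ⟨a / (a + b), b / (a + b), by positivity, by positivity,
      by rw [← add_div, div_self h.ne'], div_mul_cancel₀ _ h.ne', div_mul_cancel₀ _ h.ne'⟩

theorem eLpNorm_fourierMultiplier_le {n : ℕ} {u : HilbertBasis ℕ ℂ (L2 n)} {lam : ℕ → ℝ}
    {σ : ℕ → ℂ} {A : L2 n →ₗ.[ℂ] L2 n} (hA : IsFourierMultiplier u lam σ A)
    {p q q' : ℝ} (hp : 1 < p) (hp2 : p ≤ 2) (hq : 2 ≤ q) (hqq : q'.HolderConjugate q)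
    {B : ℝ} (hB : 0 < B) (h : symbolBound u σ (1 / p - 1 / q) ≤ ENNReal.ofReal B) (f : A.domain) :
    eLpNorm (A f) (ENNReal.ofReal q) volume ≤
      ENNReal.ofReal (√(2 / (p - 1)) * √(2 / (q' - 1))) * ENNReal.ofReal B *
        eLpNorm (f : L2 n) (ENNReal.ofReal p) volume := by
  have hq'1 : 1 < q' := hqq.lt
  have hinv := hqq.inv_add_inv_eq_one
  have hq'2 : q' ≤ 2 := by
    by_contra! hlt
    have h1 : q'⁻¹ < 2⁻¹ := inv_strictAnti₀ two_pos hlt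
    have h2 : q⁻¹ ≤ 2⁻¹ := inv_anti₀ two_pos hq
    linarith
  have ha : 0 ≤ 1 / p - 1 / 2 := sub_nonneg.2 (one_div_le_one_div_of_le (by linarith) hp2)
  have hb : 0 ≤ 1 / q' - 1 / 2 := sub_nonneg.2 (one_div_le_one_div_of_le (by linarith) hq'2)
  have hab : 1 / p - 1 / q = (1 / p - 1 / 2) + (1 / q' - 1 / 2) := by
    rw [one_div q, one_div q']; linarith
  obtain ⟨s, t, hs, ht, hst, hsa, htb⟩ := exists_convex_weights ha hb
  rw [← hab] at hsa htb
  refine eLpNorm_le_of_enorm_inner_le hqq hq (A f) fun g => ?_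
  have hPf := tsum_ofReal_sq_mul_enorm_inner_sq_le u.orthonormal hp hp2
    (φ := fun j => ‖σ j‖ ^ s) (fun j => by positivity) (B := B ^ s) (by positivity)
    (fun r hr hex => by rw [← hsa]; exact ofReal_mul_tsum_rpow_le hB hs h hr hex) (f : L2 n)
  have hPg := tsum_ofReal_sq_mul_enorm_inner_sq_le u.orthonormal hq'1 hq'2
    (φ := fun j => ‖σ j‖ ^ t) (fun j => by positivity) (B := B ^ t) (by positivity)
    (fun r hr hex => by rw [← htb]; exact ofReal_mul_tsum_rpow_le hB ht h hr hex) g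
  have hterm : ∀ j, ‖inner ℂ g (u j) * inner ℂ (u j) (A f)‖ₑ =
      (ENNReal.ofReal (‖σ j‖ ^ s) * ‖inner ℂ (u j) (f : L2 n)‖ₑ) *
        (ENNReal.ofReal (‖σ j‖ ^ t) * ‖inner ℂ (u j) g‖ₑ) := by
    intro j
    have h1 : inner ℂ (u j) (A f) = σ j * inner ℂ (u j) (f : L2 n) := by
      rw [← oscFourier_eq_inner, hA.fourier_apply, oscFourier_eq_inner]
    have h2 : ‖inner ℂ g (u j)‖ₑ = ‖inner ℂ (u j) g‖ₑ := by
      rw [← ofReal_norm, ← ofReal_norm, norm_inner_symm]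
    have h3 : ‖σ j‖ₑ = ENNReal.ofReal (‖σ j‖ ^ s) * ENNReal.ofReal (‖σ j‖ ^ t) := by
      rw [← ENNReal.ofReal_mul (by positivity), ← Real.rpow_add_of_nonneg (norm_nonneg _) hs ht,
        hst, Real.rpow_one, ofReal_norm]
    rw [h1, enorm_mul, enorm_mul, h2, h3]
    ring
  have hroot : ∀ {K x : ℝ≥0∞}, (K * x ^ 2) ^ (1 / 2 : ℝ) = K ^ (1 / 2 : ℝ) * x := by
    intro K x
    rw [ENNReal.mul_rpow_of_nonneg _ _ (by norm_num), ← ENNReal.rpow_natCast, ← ENNReal.rpow_mul]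
    norm_num
  calc ‖inner ℂ g (A f)‖ₑ
      ≤ ∑' j, ‖inner ℂ g (u j) * inner ℂ (u j) (A f)‖ₑ := by
        rw [← u.tsum_inner_mul_inner g (A f)]
        exact enorm_tsum_le_tsum_enorm
    _ ≤ (∑' j, ENNReal.ofReal (‖σ j‖ ^ s) ^ 2 * ‖inner ℂ (u j) (f : L2 n)‖ₑ ^ 2) ^ (1 / 2 : ℝ) *
          (∑' j, ENNReal.ofReal (‖σ j‖ ^ t) ^ 2 * ‖inner ℂ (u j) g‖ₑ ^ 2) ^ (1 / 2 : ℝ) := by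
        simp_rw [hterm, ← mul_pow]
        exact tsum_mul_le_sqrt_mul_sqrt _ _
    _ ≤ _ := mul_le_mul' (ENNReal.rpow_le_rpow hPf (by norm_num))
          (ENNReal.rpow_le_rpow hPg (by norm_num))
    _ = _ := by
        have hBst : ENNReal.ofReal B = ENNReal.ofReal (B ^ s) * ENNReal.ofReal (B ^ t) := by
          rw [← ENNReal.ofReal_mul (by positivity), ← Real.rpow_add hB, hst, Real.rpow_one]
        have hp1 : 0 < p - 1 := by linarith
        have hq1 : 0 < q' - 1 := by linarith
        rw [hroot, hroot, hBst, ENNReal.ofReal_mul (by positivity), Real.sqrt_eq_rpow,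
          Real.sqrt_eq_rpow, ENNReal.ofReal_rpow_of_pos (by positivity),
          ENNReal.ofReal_rpow_of_pos (by positivity)]
        ring

/-! ### Extension to `L^p`. -/

/-- The elements of the domain of `A` that lie in `L^p`. -/
def lpDomain {n : ℕ} (A : L2 n →ₗ.[ℂ] L2 n) (p : ℝ≥0∞) : Submodule ℂ A.domain where
  carrier := {f | MemLp (f : L2 n) p volume}
  add_mem' {f g} hf hg := (memLp_congr_ae (Lp.coeFn_add (f : L2 n) (g : L2 n))).2 (hf.add hg)
  zero_mem' := (memLp_congr_ae (Lp.coeFn_zero ℂ 2 volume)).2 MemLp.zero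
  smul_mem' c f hf := (memLp_congr_ae (Lp.coeFn_smul c (f : L2 n))).2 (hf.const_smul c)

theorem memLp_coe_lpDomain {n : ℕ} {A : L2 n →ₗ.[ℂ] L2 n} {p : ℝ≥0∞} (f : lpDomain A p) :
    MemLp (f.1 : L2 n) p volume :=
  f.2

/-- The inclusion of `lpDomain A p` in `L^p`. -/
noncomputable def lpInclusion {n : ℕ} (A : L2 n →ₗ.[ℂ] L2 n) (p : ℝ≥0∞) :
    lpDomain A p →ₗ[ℂ] Lp ℂ p (volume : Measure (EuclideanSpace ℝ (Fin n))) where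
  toFun f := (memLp_coe_lpDomain f).toLp _
  map_add' f g := by
    rw [← MemLp.toLp_add]
    exact MemLp.toLp_congr _ _ (Lp.coeFn_add (f.1 : L2 n) (g.1 : L2 n))
  map_smul' c f := by
    rw [RingHom.id_apply, ← MemLp.toLp_const_smul]
    exact MemLp.toLp_congr _ _ (Lp.coeFn_smul c (f.1 : L2 n))

/-- A linear operator in `L²` as a map into `L^q`, when its values lie in `L^q`. -/
noncomputable def lpRestrict {n : ℕ} (A : L2 n →ₗ.[ℂ] L2 n) (p q : ℝ≥0∞)
    (h : ∀ f : lpDomain A p, MemLp (A f.1) q volume) :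
    lpDomain A p →ₗ[ℂ] Lp ℂ q (volume : Measure (EuclideanSpace ℝ (Fin n))) where
  toFun f := MemLp.toLp _ (h f)
  map_add' f g := by
    rw [← MemLp.toLp_add]
    refine MemLp.toLp_congr _ _ ?_
    rw [Submodule.coe_add, LinearPMap.map_add]
    exact Lp.coeFn_add (A f.1) (A g.1)
  map_smul' c f := by
    rw [RingHom.id_apply, ← MemLp.toLp_const_smul]
    refine MemLp.toLp_congr _ _ ?_
    rw [Submodule.coe_smul, LinearPMap.map_smul]
    exact Lp.coeFn_smul c (A f.1)

/-- Conjugates of Schwartz functions are smooth vectors, so they lie in the domain, and they are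
already dense in `L^p`. -/
theorem denseRange_lpInclusion {n k l : ℕ} {u : HilbertBasis ℕ ℂ (L2 n)} {lam : ℕ → ℝ}
    (hu : IsEigenbasis n k l u lam) {A : L2 n →ₗ.[ℂ] L2 n}
    (hA : smoothVectors u lam ⊆ A.domain) {p : ℝ≥0∞} [Fact (1 ≤ p)] (hp : p ≠ ∞) :
    DenseRange (lpInclusion A p) := by
  refine (denseRange_star_toLp n hp).mono ?_
  rintro _ ⟨g, rfl⟩
  have hae : ((star (g.toLp 2 volume) : L2 n) : EuclideanSpace ℝ (Fin n) → ℂ) =ᵐ[volume]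
      (star (g.toLp p volume) : Lp ℂ p (volume : Measure (EuclideanSpace ℝ (Fin n)))) := by
    filter_upwards [Lp.coeFn_star (g.toLp 2 volume : L2 n), g.coeFn_toLp 2 volume,
      Lp.coeFn_star (g.toLp p volume : Lp ℂ p volume), g.coeFn_toLp p volume] with x h1 h2 h3 h4
    rw [h1, h3, Pi.star_apply, Pi.star_apply, h2, h4]
  refine ⟨⟨⟨_, hA (star_toLp_mem_smoothVectors hu g)⟩,
    (memLp_congr_ae hae).2 (Lp.memLp _)⟩, ?_⟩
  exact Lp.ext ((MemLp.coeFn_toLp ((memLp_congr_ae hae).2 (Lp.memLp _))).trans hae)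

theorem exists_unique_extension {n k l : ℕ} {u : HilbertBasis ℕ ℂ (L2 n)} {lam : ℕ → ℝ}
    (hu : IsEigenbasis n k l u lam) {A : L2 n →ₗ.[ℂ] L2 n}
    (hA : smoothVectors u lam ⊆ A.domain) {p q : ℝ≥0∞} [Fact (1 ≤ p)] [Fact (1 ≤ q)]
    (hp : p ≠ ∞) {M : ℝ≥0∞} (hM : M ≠ ∞)
    (h : ∀ f : A.domain, MemLp (f : L2 n) p volume →
      eLpNorm (A f) q volume ≤ M * eLpNorm (f : L2 n) p volume) :
    ∃ T : Lp ℂ p (volume : Measure (EuclideanSpace ℝ (Fin n))) →L[ℂ]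
        Lp ℂ q (volume : Measure (EuclideanSpace ℝ (Fin n))),
      Extends A T ∧ ‖T‖ₑ ≤ M ∧
        ∀ T' : Lp ℂ p (volume : Measure (EuclideanSpace ℝ (Fin n))) →L[ℂ]
          Lp ℂ q (volume : Measure (EuclideanSpace ℝ (Fin n))), Extends A T' → T' = T := by
  have hmem : ∀ f : lpDomain A p, MemLp (A f.1) q volume := fun f =>
    ⟨Lp.aestronglyMeasurable _, (h f.1 f.2).trans_lt
      (ENNReal.mul_lt_top hM.lt_top ((memLp_coe_lpDomain f).eLpNorm_lt_top))⟩
  have hdense := denseRange_lpInclusion hu hA hp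
  have hbound : ∀ f, ‖lpRestrict A p q hmem f‖ ≤ M.toReal * ‖lpInclusion A p f‖ := by
    intro f
    change ‖MemLp.toLp _ (hmem f)‖ ≤ M.toReal * ‖(memLp_coe_lpDomain f).toLp _‖
    rw [Lp.norm_toLp, Lp.norm_toLp, ← ENNReal.toReal_mul]
    exact ENNReal.toReal_mono (ENNReal.mul_ne_top hM ((memLp_coe_lpDomain f).eLpNorm_ne_top)) (h f.1 f.2)
  have hext : ∀ f, (lpRestrict A p q hmem).extendOfNorm (lpInclusion A p) (lpInclusion A p f) =
      lpRestrict A p q hmem f := LinearMap.extendOfNorm_eq hdense ⟨_, hbound⟩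
  refine ⟨(lpRestrict A p q hmem).extendOfNorm (lpInclusion A p), fun f hf => ?_, ?_,
    fun T' hT' => ?_⟩
  · rw [show hf.toLp _ = lpInclusion A p ⟨f, hf⟩ from rfl, hext]
    exact MemLp.coeFn_toLp (hmem ⟨f, hf⟩)
  · rw [← ofReal_norm, ← ENNReal.ofReal_toReal hM]
    exact ENNReal.ofReal_le_ofReal
      (LinearMap.opNorm_extendOfNorm_le hdense ENNReal.toReal_nonneg hbound)
  · refine ContinuousLinearMap.coeFn_injective
      (hdense.equalizer T'.continuous (ContinuousLinearMap.continuous _) (funext fun f => ?_))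
    rw [Function.comp_apply, Function.comp_apply, hext]
    refine Lp.ext ((hT' f.1 f.2).trans ?_)
    exact (MemLp.coeFn_toLp (hmem f)).symm

end Anharmonic

/-! ### The main theorem. -/

theorem theorem4p4 (p q : ℝ≥0∞) [Fact (1 ≤ p)] [Fact (1 ≤ q)]
    (hp : 1 < p) (hp2 : p ≤ 2) (hq2 : 2 ≤ q) (hq : q < ∞) :
    ∃ C : ℝ≥0, ∀ (n k l : ℕ), 1 ≤ n → 1 ≤ k → 1 ≤ l →
      ∀ (u : HilbertBasis ℕ ℂ (Anharmonic.L2 n)) (lam : ℕ → ℝ),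
        Anharmonic.IsEigenbasis n k l u lam →
      ∀ (σ : ℕ → ℂ) (A : Anharmonic.L2 n →ₗ.[ℂ] Anharmonic.L2 n),
        Anharmonic.IsFourierMultiplier u lam σ A →
        Anharmonic.opNorm A p q ≤
            C * Anharmonic.symbolBound u σ (1 / p.toReal - 1 / q.toReal) ∧
          (Anharmonic.symbolBound u σ (1 / p.toReal - 1 / q.toReal) < ∞ →
            ∃ T : Lp ℂ p (volume : Measure (EuclideanSpace ℝ (Fin n))) →L[ℂ]
                Lp ℂ q (volume : Measure (EuclideanSpace ℝ (Fin n))),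
              Anharmonic.Extends A T ∧
                ‖T‖ₑ ≤ C * Anharmonic.symbolBound u σ (1 / p.toReal - 1 / q.toReal) ∧
                ∀ T' : Lp ℂ p (volume : Measure (EuclideanSpace ℝ (Fin n))) →L[ℂ]
                  Lp ℂ q (volume : Measure (EuclideanSpace ℝ (Fin n))),
                  Anharmonic.Extends A T' → T' = T) := by
  have hpt : p ≠ ∞ := ne_top_of_le_ne_top ENNReal.ofNat_ne_top hp2
  have hp1 : 1 < p.toReal := by
    simpa using (ENNReal.toReal_lt_toReal ENNReal.one_ne_top hpt).2 hp
  have hp2' : p.toReal ≤ 2 := by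
    simpa using (ENNReal.toReal_le_toReal hpt ENNReal.ofNat_ne_top).2 hp2
  have hq2' : 2 ≤ q.toReal := by
    simpa using (ENNReal.toReal_le_toReal ENNReal.ofNat_ne_top hq.ne).2 hq2
  have hqq := (Real.HolderConjugate.conjExponent (show 1 < q.toReal by linarith)).symm
  have hq'1 := hqq.lt
  set q' := Real.conjExponent q.toReal
  set K : ℝ := √(2 / (p.toReal - 1)) * √(2 / (q' - 1))
  have hKpos : 0 < K :=
    mul_pos (Real.sqrt_pos.2 (div_pos two_pos (sub_pos.2 hp1)))
      (Real.sqrt_pos.2 (div_pos two_pos (sub_pos.2 hq'1)))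
  refine ⟨K.toNNReal, fun n k l _ _ _ u lam hu σ A hA => ?_⟩
  set S := Anharmonic.symbolBound u σ (1 / p.toReal - 1 / q.toReal)
  have hbound : S < ∞ → ∀ f : A.domain, MemLp (f : Anharmonic.L2 n) p volume →
      eLpNorm (A f) q volume ≤ (K.toNNReal * S) * eLpNorm (f : Anharmonic.L2 n) p volume := by
    intro hSfin f hf
    -- The multiplier bound needs a positive finite `B`, while `S` may be `0`; so it is applied for
    -- `B > S` and then `B` tends to `S`.
    have hne : (nhdsWithin S (Set.Ioi S)).NeBot := nhdsGT_neBot_of_exists_gt ⟨∞, hSfin⟩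
    have hlim : Filter.Tendsto
        (fun B : ℝ≥0∞ => K.toNNReal * B * eLpNorm (f : Anharmonic.L2 n) p volume)
        (nhdsWithin S (Set.Ioi S))
        (nhds (K.toNNReal * S * eLpNorm (f : Anharmonic.L2 n) p volume)) := by
      refine Filter.Tendsto.mono_left ?_ nhdsWithin_le_nhds
      exact ENNReal.Tendsto.mul_const
        (ENNReal.Tendsto.const_mul Filter.tendsto_id (Or.inr ENNReal.coe_ne_top))
        (Or.inr hf.eLpNorm_ne_top)
    refine ge_of_tendsto hlim (Filter.eventually_of_mem self_mem_nhdsWithin fun B hB => ?_)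
    rcases eq_or_ne B ∞ with rfl | hBt
    -- For `B = ∞` the right side is `∞` unless `f` has norm zero, where `∞ * 0 = 0` and the left
    -- side must vanish too.
    · rcases eq_or_ne (eLpNorm (f : Anharmonic.L2 n) p volume) 0 with h0 | h0
      · have hf0 : (f : Anharmonic.L2 n) = 0 := by
          rw [eLpNorm_eq_zero_iff (Lp.aestronglyMeasurable _) (zero_lt_one.trans hp).ne'] at h0
          exact Lp.eq_zero_iff_ae_eq_zero.2 h0
        rw [show f = 0 from Subtype.ext hf0, LinearPMap.map_zero,
          eLpNorm_congr_ae (Lp.coeFn_zero ℂ 2 volume), eLpNorm_zero]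
        exact zero_le
      · rw [ENNReal.mul_top (by simpa using hKpos), ENNReal.top_mul h0]
        exact le_top
    · have hB0 : 0 < B.toReal := ENNReal.toReal_pos ((zero_le).trans_lt hB).ne' hBt
      have h := Anharmonic.eLpNorm_fourierMultiplier_le hA hp1 hp2' hq2' hqq hB0
        (by rw [ENNReal.ofReal_toReal hBt]; exact (le_of_lt hB)) f
      rwa [ENNReal.ofReal_toReal hBt, ENNReal.ofReal_toReal hq.ne, ENNReal.ofReal_toReal hpt] at h
  refine ⟨?_, fun hSfin => Anharmonic.exists_unique_extension hu hA.smooth_subset_domain hpt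
    (ENNReal.mul_ne_top ENNReal.coe_ne_top hSfin.ne) (hbound hSfin)⟩
  rcases eq_or_ne S ∞ with hSt | hSt
  · rw [hSt, ENNReal.mul_top (by simpa using hKpos)]
    exact le_top
  · exact sInf_le (hbound hSt.lt_top)
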